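/- **Setting.** For $f:\{0,1\}^n\to\{0,1\}$ and uniformly random $\boldsymbol x\in\{0,1\}^n$ let $\mathrm{dist}(f,g)=\Pr[f(\boldsymbol x)\ne g(\boldsymbol x)]$, $\mathrm{bias}(f)=\min\{\mathrm{dist}(f,0),\mathrm{dist}(f,1)\}$, $\mathrm{Inf}_i[f]=\Pr[f(\boldsymbol x)\neq f(\boldsymbol x^{\oplus i})]$ (where $x^{\oplus i}$ is $x$ with its $i$-th bit flipped) and $\mathbf I[f]=\sum_{i=1}^n\mathrm{Inf}_i[f]$. For a partial assignment $\pi$ of the variables, $f_\pi$ is the restriction of $f$ by $\pi$. Let $c\in\mathbb R_{\ge0}^n$ be a cost vector. An *offline* algorithm is a deterministic decision tree; on input $x$ its cost is the sum of $c_i$ over the variables $x_i$ it queries. An *online* algorithm with unit investment $\beta>0$ is a deterministic algorithm that knows $f$ but neither $x$ nor $c$. It maintains investments $\theta\in\mathbb R_{\ge0}^n$, initially $0$. At each step, depending only on what it has seen so far, it either halts with an output bit or picks some $i$ and increases $\theta_i$ by $\beta$, whereupon $x_i$ is revealed to it if $\theta_i\ge c_i$. Its cost on $x$ is $\|\theta\|_1$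 when it halts. An algorithm is *$\varepsilon$-error* for $f$ (with respect to $c$) if it halts on every input and its output differs from $f(\boldsymbol x)$ with probability at most $\varepsilon$. Let $\mathrm{opt}^{\mathrm w}_0=\mathrm{opt}^{\mathrm w}_0(f,c)$ be the infimum, over all zero-error (offline or online) algorithms for $f$, of the maximum cost over $x\in\{0,1\}^n$. **Algorithm Warmup-IPRR$(f,\varepsilon)$ with unit investment $\beta$.** Start with $\theta=0^n$ and $\pi=\emptyset$. While $\mathrm{bias}(f_\pi)>\varepsilon$: choose $i^*$ maximizing $\mathrm{Inf}_i[f_\pi]/\theta_i$ over $i\in[n]$ (with $a/0=\infty$ for $a>0$ and $0/0=0$; ties broken arbitrarily, as a function of the history), increase $\theta_{i^*}$ by $\beta$, and if $x_{i^*}$ is revealed to be $b$, add $x_{i^*}\mapsto b$ to $\pi$. When the loop ends, output $1$ if $\mathbb E[f_\pi(\boldsymbol x)]\ge 1/2$ and $0$ otherwise. **Theorem.** There is a universal constant $K>0$ such that the following holds for all $n$, all $f:\{0,1\}^n\to\{0,1\}$, all $\varepsilon\in(0,1/2]$ and all $\beta>0$. The algorithm Warmup-IPRR$(f,\varepsilon)$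 with unit investment $\beta$ is well defined, and for every way of breaking ties and every cost vector $c\in\mathbb R_{\ge0}^n$ it is an $\varepsilon$-error online algorithm for $f$ whose expected cost on a uniformly random input is at most $$\beta n+\frac{\mathrm{opt}^{\mathrm w}_0(f,c)}{\varepsilon}\sum_{i=1}^n\mathrm{Inf}_i[f]\Bigl(1+\ln\frac1{\mathrm{Inf}_i[f]}\Bigr)$$ (where terms with $\mathrm{Inf}_i[f]=0$ are $0$) and, if $n\ge2$, also at most $$\beta n+K\cdot\mathrm{opt}^{\mathrm w}_0(f,c)\cdot\frac{\mathbf I[f]\,\log_2 n}{\varepsilon}.$$ -/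

import Mathlib

namespace PricedQuery

/-! ### Boolean functions on the uniform cube -/

/-- Points of the cube `{0,1}^n`. -/
abbrev Cube (n : ℕ) : Type := Fin n → Bool

/-- The probability that `P x` holds for a uniformly random `x` in the cube. -/
noncomputable def prob {n : ℕ} (P : Cube n → Prop) [DecidablePred P] : ℝ :=
  ((Finset.univ.filter P).card : ℝ) / 2 ^ n

/-- The expectation of `g x` for a uniformly random `x` in the cube. -/
noncomputable def expect {n : ℕ} (g : Cube n → ℝ) : ℝ :=
  (∑ x, g x) / 2 ^ n

/-- The fraction of inputs on which two Boolean functions differ. -/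
noncomputable def dist {n : ℕ} (f g : Cube n → Bool) : ℝ :=
  prob fun x => f x ≠ g x

/-- The distance to the nearest constant function. -/
noncomputable def bias {n : ℕ} (f : Cube n → Bool) : ℝ :=
  min (dist f fun _ => false) (dist f fun _ => true)

/-- The input `x` with its `i`-th bit flipped. -/
def flipBit {n : ℕ} (x : Cube n) (i : Fin n) : Cube n :=
  Function.update x i (!(x i))

/-- The influence of the `i`-th variable. -/
noncomputable def influence {n : ℕ} (f : Cube n → Bool) (i : Fin n) : ℝ :=
  prob fun x => f x ≠ f (flipBit x i)

/-- The total influence. -/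
noncomputable def totalInfluence {n : ℕ} (f : Cube n → Bool) : ℝ :=
  ∑ i, influence f i

/-- A restriction fixes some of the variables (those mapped to `some b`). -/
abbrev Restriction (n : ℕ) : Type := Fin n → Option Bool

/-- The restricted function `f_π`, as a function on the whole cube that ignores the variables
fixed by `π`. -/
def restrict {n : ℕ} (f : Cube n → Bool) (π : Restriction n) : Cube n → Bool :=
  fun x => f fun i => (π i).getD (x i)

/-! ### Offline query algorithms: decision trees -/

/-- Deterministic decision trees over `n` Boolean variables; the two subtrees of a query are for
the answers `false` and `true`, in this order. -/
inductive DecisionTree (n : ℕ) : Type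
  | leaf (b : Bool) : DecisionTree n
  | query (i : Fin n) (t₀ t₁ : DecisionTree n) : DecisionTree n

/-- The output of the tree on input `x`. -/
def DecisionTree.eval {n : ℕ} : DecisionTree n → Cube n → Bool
  | .leaf b, _ => b
  | .query i t₀ t₁, x => if x i then t₁.eval x else t₀.eval x

/-- The set of variables queried by the tree on input `x`. -/
def DecisionTree.queried {n : ℕ} : DecisionTree n → Cube n → Finset (Fin n)
  | .leaf _, _ => ∅
  | .query i t₀ t₁, x => insert i (if x i then t₁.queried x else t₀.queried x)

/-- The cost of the tree on input `x`: the price `c i` is paid to reveal the bit `x i`. -/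
noncomputable def DecisionTree.cost {n : ℕ} (T : DecisionTree n) (c : Fin n → ℝ) (x : Cube n) : ℝ :=
  ∑ i ∈ T.queried x, c i

/-! ### Online query algorithms -/

/-- What an online algorithm has seen so far, most recent event first. The event `(i, none)` is
an investment in variable `i` after which `x i` is still hidden; `(i, some b)` is an investment in
variable `i` after which `x i` is known to be `b`. -/
abbrev History (n : ℕ) : Type := List (Fin n × Option Bool)

/-- A deterministic online algorithm: as a function of the history alone, it either invests one
more unit in a variable (`Sum.inl i`) or halts with an output bit (`Sum.inr b`). -/
abbrev OnlineAlg (n : ℕ) : Type := History n → Fin n ⊕ Bool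

/-- The cumulative investment `θ i` after the history `h`, with unit investment `β`. -/
noncomputable def investment {n : ℕ} (β : ℝ) (h : History n) (i : Fin n) : ℝ :=
  β * (h.countP fun e => e.1 = i)

/-- The restriction `π` given by the bits revealed in the history. -/
def revealed {n : ℕ} : History n → Restriction n
  | [] => fun _ => none
  | (_, none) :: h => revealed h
  | (i, some b) :: h => Function.update (revealed h) i (some b)

open Classical in
/-- The answer to investing one more unit in variable `i` after the history `h`: the bit is
revealed once the cumulative investment reaches or exceeds the cost. -/
noncomputable def feedback {n : ℕ} (β : ℝ) (c : Fin n → ℝ) (x : Cube n) (h : History n)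
    (i : Fin n) : Option Bool :=
  if c i ≤ investment β h i + β then some (x i) else none

/-- The history after `t` steps on input `x` with costs `c` (it no longer changes once the
algorithm has halted). -/
noncomputable def run {n : ℕ} (A : OnlineAlg n) (β : ℝ) (c : Fin n → ℝ) (x : Cube n) :
    ℕ → History n
  | 0 => []
  | t + 1 =>
    match A (run A β c x t) with
    | .inl i => (i, feedback β c x (run A β c x t) i) :: run A β c x t
    | .inr _ => run A β c x t

/-- The algorithm halts on input `x` with costs `c`. -/
def Halts {n : ℕ} (A : OnlineAlg n) (β : ℝ) (c : Fin n → ℝ) (x : Cube n) : Prop :=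
  ∃ t, ∃ b, A (run A β c x t) = .inr b

open Classical in
/-- The history at the moment of halting (the empty history if the algorithm does not halt). -/
noncomputable def finalHistory {n : ℕ} (A : OnlineAlg n) (β : ℝ) (c : Fin n → ℝ) (x : Cube n) :
    History n :=
  if H : Halts A β c x then run A β c x (Nat.find H) else []

/-- The output bit at the moment of halting. -/
noncomputable def onlineOutput {n : ℕ} (A : OnlineAlg n) (β : ℝ) (c : Fin n → ℝ) (x : Cube n) :
    Bool :=
  match A (finalHistory A β c x) with
  | .inl _ => false
  | .inr b => b

/-- The total cost: the sum of all investments at the moment of halting. -/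
noncomputable def onlineCost {n : ℕ} (A : OnlineAlg n) (β : ℝ) (c : Fin n → ℝ) (x : Cube n) : ℝ :=
  ∑ i, investment β (finalHistory A β c x) i

/-- With unit investment `β` and costs `c`, the algorithm halts on every input and its output
differs from `f` on at most an `ε` fraction of the inputs. -/
def IsErrorOnline {n : ℕ} (f : Cube n → Bool) (ε β : ℝ) (c : Fin n → ℝ) (A : OnlineAlg n) : Prop :=
  (∀ x, Halts A β c x) ∧ dist f (onlineOutput A β c) ≤ ε

/-- The expected cost on a uniformly random input. -/
noncomputable def avgOnlineCost {n : ℕ} (A : OnlineAlg n) (β : ℝ) (c : Fin n → ℝ) : ℝ :=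
  expect (onlineCost A β c)

/-! ### The benchmark -/

/-- The infimum of the worst-case costs of all `ε`-error query algorithms for `f`, offline or
online (with any unit investment). -/
noncomputable def optWorst {n : ℕ} (ε : ℝ) (f : Cube n → Bool) (c : Fin n → ℝ) : ℝ :=
  sInf ({w : ℝ | ∃ T : DecisionTree n, dist f T.eval ≤ ε ∧ w = ⨆ x, T.cost c x} ∪
    {w : ℝ | ∃ (β : ℝ) (B : OnlineAlg n), 0 < β ∧ IsErrorOnline f ε β c B ∧
      w = ⨆ x, onlineCost B β c x})

/-! ### The algorithm -/

/-- The ratio `Inf_i[f_π] / θ_i` after the history `h`. In `ℝ≥0∞` it is `⊤` if `θ_i = 0` and the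
influence is positive, and `0` if both vanish. -/
noncomputable def influenceRatio {n : ℕ} (f : Cube n → Bool) (β : ℝ) (h : History n) (i : Fin n) :
    ENNReal :=
  ENNReal.ofReal (influence (restrict f (revealed h)) i) / ENNReal.ofReal (investment β h i)

open Classical in
/-- `A` is an implementation of Warmup-IPRR: while `bias(f_π) > ε` it invests in a variable that
maximizes `Inf_i[f_π] / θ_i` (ties may be broken in any way), and as soon as `bias(f_π) ≤ ε` it
halts and outputs `1` if and only if `𝔼[f_π] ≥ 1/2`. -/
def IsWarmupIPRR {n : ℕ} (f : Cube n → Bool) (ε β : ℝ) (A : OnlineAlg n) : Prop :=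
  ∀ h : History n,
    (ε < bias (restrict f (revealed h)) →
      ∃ i, A h = .inl i ∧ ∀ j, influenceRatio f β h j ≤ influenceRatio f β h i) ∧
    (bias (restrict f (revealed h)) ≤ ε →
      A h = .inr (decide (1 / 2 ≤ prob fun x => restrict f (revealed h) x = true)))

end PricedQuery

namespace PricedQuery

variable {n : ℕ}

/-! ### Expectations over the cube -/

/-! The analysis compares the algorithm with an arbitrary exact decision tree `T` for `f` of
worst-case cost at most `w`. An OSSS-type covariance inequality (`covariance_le`) shows that
`bias(f_π)` is at most the sum over free `j` of (probability that `T` queries `j`) · `Inf_j[f_π]`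
(`bias_restrict_le`). While the algorithm runs, this sum exceeds `ε`. Multiply by `θ_i` for the
chosen `i`: the greedy rule gives `Inf_j θ_i ≤ Inf_i θ_j`, and `θ_j ≤ c_j` for every hidden `j`, so
`ε θ_i ≤ Inf_i[f_π] · w`, since the expected cost of `T` is at most `w`
(`IsWarmupIPRR.investment_le`). Moreover `θ_i ≤ c_i ≤ w` when `Inf_i[f_π] > 0`. Hence, for every `s
≥ ε`, the final investment in `i` is at most `β + (w/ε) · min(s, M_i)`, where `M_i` is the largest
influence of `i` seen along the run.

On a uniform input, `Inf_i[f_π]` is a nonnegative supermartingale along the run. A Doob-type maximal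
inequality, proved through the potential `min(s,m) + v ln(s / min(s,m))`, bounds the expectation of
`min(s, M_i)` (`expect_min_maxInfluence_le`). Taking `s = 1` gives the entropy-like bound; `s = ε`
gives the bound with `log n`.

Conditioned on the history, the hidden bits stay uniform (`expect_resample`), so the error is an
average of biases that are at most `ε`. Online competitors are covered because an exact online
algorithm can be simulated by a decision tree that is no more expensive (`le_optWorst_zero`). -/

/-- The input obtained from `x` by overwriting the variables fixed by `π`. -/
def override (π : Restriction n) (x : Cube n) : Cube n :=
  fun i => (π i).getD (x i)

lemma restrict_apply (f : Cube n → Bool) (π : Restriction n) (x : Cube n) :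
    restrict f π x = f (override π x) := rfl

lemma prob_eq_expect (P : Cube n → Prop) [DecidablePred P] :
    prob P = expect fun x => if P x then (1 : ℝ) else 0 := by
  simp [prob, expect]

lemma expect_add (F G : Cube n → ℝ) :
    expect (fun x => F x + G x) = expect F + expect G := by
  simp [expect, Finset.sum_add_distrib, add_div]

lemma expect_sub (F G : Cube n → ℝ) :
    expect (fun x => F x - G x) = expect F - expect G := by
  simp [expect, Finset.sum_sub_distrib, sub_div]

lemma expect_const_mul (a : ℝ) (F : Cube n → ℝ) :
    expect (fun x => a * F x) = a * expect F := by
  rw [expect, expect, ← mul_div_assoc, Finset.mul_sum]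

lemma expect_const (a : ℝ) : expect (fun _ : Cube n => a) = a := by
  simp [expect]

lemma expect_sum {ι : Type*} (s : Finset ι) (F : ι → Cube n → ℝ) :
    expect (fun x => ∑ j ∈ s, F j x) = ∑ j ∈ s, expect (F j) := by
  simp only [expect, Finset.sum_div]
  exact Finset.sum_comm

lemma expect_mono {F G : Cube n → ℝ} (h : ∀ x, F x ≤ G x) : expect F ≤ expect G := by
  unfold expect
  have := Finset.sum_le_sum fun x (_ : x ∈ Finset.univ) => h x
  gcongr

lemma expect_nonneg {F : Cube n → ℝ} (h : ∀ x, 0 ≤ F x) : 0 ≤ expect F := by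
  simpa [expect_const] using expect_mono (F := fun _ => 0) h

lemma prob_nonneg (P : Cube n → Prop) [DecidablePred P] : 0 ≤ prob P := by
  unfold prob; positivity

lemma prob_le_one (P : Cube n → Prop) [DecidablePred P] : prob P ≤ 1 := by
  rw [prob_eq_expect]
  exact (expect_mono fun x => by split_ifs <;> norm_num).trans_eq (expect_const 1)

lemma prob_pos {P : Cube n → Prop} [DecidablePred P] {x : Cube n} (h : P x) : 0 < prob P := by
  unfold prob
  have : 0 < (Finset.univ.filter P).card := Finset.card_pos.2 ⟨x, by simpa using h⟩
  positivity

lemma exists_of_prob_pos {P : Cube n → Prop} [DecidablePred P] (h : 0 < prob P) : ∃ x, P x := by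
  by_contra! hP
  simp [prob, hP] at h

lemma influence_nonneg (f : Cube n → Bool) (i : Fin n) : 0 ≤ influence f i := prob_nonneg _

lemma influence_le_one (f : Cube n → Bool) (i : Fin n) : influence f i ≤ 1 := prob_le_one _

lemma eq_of_dist_nonpos {f g : Cube n → Bool} (h : dist f g ≤ 0) : f = g := by
  by_contra hne
  obtain ⟨x, hx⟩ := Function.ne_iff.1 hne
  exact h.not_gt (prob_pos (P := fun x => f x ≠ g x) hx)

@[simp] lemma flipBit_same (x : Cube n) (i : Fin n) : flipBit x i i = !x i := by
  simp [flipBit]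

lemma flipBit_of_ne (x : Cube n) {i j : Fin n} (h : j ≠ i) : flipBit x i j = x j := by
  simp [flipBit, h]

@[simp] lemma flipBit_flipBit (x : Cube n) (i : Fin n) : flipBit (flipBit x i) i = x := by
  simp [flipBit]

lemma expect_flipBit (F : Cube n → ℝ) (i : Fin n) :
    expect (fun x => F (flipBit x i)) = expect F := by
  unfold expect
  congr 1
  exact Function.Bijective.sum_comp
    (Function.Involutive.bijective fun x => flipBit_flipBit x i) F

/-- Averaging over one bit first. -/
lemma expect_ite_bit (i : Fin n) (u v : Cube n → ℝ) (hu : ∀ x, u (flipBit x i) = u x)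
    (hv : ∀ x, v (flipBit x i) = v x) :
    expect (fun x => if x i then v x else u x) = (expect u + expect v) / 2 := by
  have h : expect (fun x => if x i then v x else u x)
      + expect (fun x => if flipBit x i i then v (flipBit x i) else u (flipBit x i))
      = expect u + expect v := by
    rw [← expect_add, ← expect_add]
    congr 1
    funext x
    cases hx : x i <;> simp [hx, hu, hv, add_comm]
  rw [expect_flipBit fun x => if x i then v x else u x] at h
  linarith

lemma override_update_flipBit (π : Restriction n) (i : Fin n) (b : Bool) (x : Cube n) :
    override (Function.update π i (some b)) (flipBit x i)
      = override (Function.update π i (some b)) x := by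
  funext j
  by_cases h : j = i
  · subst h; simp [override]
  · simp [override, h, flipBit_of_ne x h]

lemma override_eq_update {π : Restriction n} {i : Fin n} (h : π i = none) (x : Cube n) :
    override π x = override (Function.update π i (some (x i))) x := by
  funext j
  by_cases hj : j = i
  · subst hj; simp [override, h]
  · simp [override, hj]

lemma override_apply_none {π : Restriction n} {i : Fin n} (h : π i = none) (x : Cube n) :
    override π x i = x i := by simp [override, h]

lemma override_apply_some {π : Restriction n} {i : Fin n} {b : Bool} (h : π i = some b)
    (x : Cube n) : override π x i = b := by simp [override, h]

/-- A quantity depending on `x` only through the fixed variables, one of which is the fresh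
variable `i`, averages over the two values of `x i`. -/
lemma expect_override {π : Restriction n} {i : Fin n} (h : π i = none) (F : Cube n → ℝ) :
    expect (fun x => F (override π x)) =
      (expect (fun x => F (override (Function.update π i (some false)) x))
        + expect (fun x => F (override (Function.update π i (some true)) x))) / 2 := by
  rw [← expect_ite_bit i]
  · congr 1
    funext x
    rw [override_eq_update h x]
    cases hx : x i <;> simp
  all_goals intro x; rw [override_update_flipBit]

/-! ### The covariance inequality for decision trees -/

/-- The probability that `T`, run under the restriction `π`, queries the free variable `j`. -/
noncomputable def queryProb (T : DecisionTree n) (π : Restriction n) (j : Fin n) : ℝ :=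
  if π j = none then expect (fun x => if j ∈ T.queried (override π x) then (1 : ℝ) else 0) else 0

lemma queryProb_nonneg (T : DecisionTree n) (π : Restriction n) (j : Fin n) :
    0 ≤ queryProb T π j := by
  unfold queryProb
  split_ifs
  · exact expect_nonneg fun x => by split_ifs <;> norm_num
  · exact le_rfl

lemma queryProb_le_one (T : DecisionTree n) (π : Restriction n) (j : Fin n) :
    queryProb T π j ≤ 1 := by
  unfold queryProb
  split_ifs
  · exact (expect_mono fun x => by split_ifs <;> norm_num).trans_eq (expect_const 1)
  · exact zero_le_one

lemma queryProb_query_some {π : Restriction n} {i : Fin n} {b : Bool} (h : π i = some b)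
    (t₀ t₁ : DecisionTree n) (j : Fin n) :
    queryProb (if b then t₁ else t₀) π j ≤ queryProb (.query i t₀ t₁) π j := by
  by_cases hj : π j = none
  · simp only [queryProb, hj, if_true]
    refine expect_mono fun x => ?_
    rw [DecisionTree.queried, override_apply_some h]
    cases b <;> simp only [Finset.mem_insert] <;> split_ifs <;> simp_all
  · simp [queryProb, hj]

/-- Fixing `i` in both subtrees makes their query probability of `i` zero, so a variable that the
tree queries repeatedly is counted only once. -/
lemma queryProb_query_none {π : Restriction n} {i : Fin n} (h : π i = none)
    (t₀ t₁ : DecisionTree n) (j : Fin n) :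
    queryProb (.query i t₀ t₁) π j = (if j = i then 1 else 0) +
      (queryProb t₀ (Function.update π i (some false)) j
        + queryProb t₁ (Function.update π i (some true)) j) / 2 := by
  by_cases hj : j = i
  · subst hj
    simp [queryProb, h, DecisionTree.queried, expect_const]
  · by_cases hπ : π j = none
    · simp only [queryProb, hπ, hj, Function.update_of_ne hj, if_true, if_false, zero_add]
      rw [expect_override h fun z => if j ∈ (DecisionTree.query i t₀ t₁).queried z then (1:ℝ) else 0]
      simp [DecisionTree.queried, override, hj]
    · simp [queryProb, hj, hπ]

/-- The covariance of a decision tree and an arbitrary function is bounded by the query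
probabilities and the `L¹` influences. -/
lemma covariance_le (T : DecisionTree n) (π : Restriction n) (g : Cube n → ℝ) :
    expect (fun x => (if T.eval (override π x) then 1 else 0) * g x)
      - expect (fun x => if T.eval (override π x) then (1 : ℝ) else 0) * expect g
      ≤ 1 / 4 * ∑ j, queryProb T π j * expect (fun x => |g x - g (flipBit x j)|) := by
  induction T generalizing π with
  | leaf b =>
    -- A constant has covariance zero with everything, so nonnegativity of the right-hand side
    -- suffices.
    have h0 : ∀ j, 0 ≤ queryProb (.leaf b) π j * expect (fun x => |g x - g (flipBit x j)|) :=
      fun j => mul_nonneg (queryProb_nonneg _ _ _) (expect_nonneg fun x => abs_nonneg _)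
    have := Finset.sum_nonneg fun j (_ : j ∈ Finset.univ) => h0 j
    have hb : ∀ x, (if (DecisionTree.leaf b).eval (override π x) then (1 : ℝ) else 0)
        = if b then 1 else 0 := fun _ => rfl
    simp only [hb]
    rw [expect_const_mul, expect_const]
    linarith
  | query i t₀ t₁ ih₀ ih₁ =>
    cases hπ : π i with
    | some b =>
      have hev : ∀ x, (DecisionTree.query i t₀ t₁).eval (override π x)
          = (if b then t₁ else t₀).eval (override π x) := fun x => by
        rw [DecisionTree.eval, override_apply_some hπ]; cases b <;> rfl
      simp only [hev]
      refine le_trans (b := 1 / 4 * ∑ j, queryProb (if b then t₁ else t₀) π j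
        * expect (fun x => |g x - g (flipBit x j)|)) (by cases b; exacts [ih₀ π, ih₁ π]) ?_
      have : ∀ j, 0 ≤ expect (fun x => |g x - g (flipBit x j)|) :=
        fun j => expect_nonneg fun x => abs_nonneg _
      gcongr with j
      · exact this j
      · exact queryProb_query_some hπ t₀ t₁ j
    | none =>
      have h₀ := ih₀ (Function.update π i (some false))
      have h₁ := ih₁ (Function.update π i (some true))
      -- The subtrees run with the root bit fixed, so `a₀` and `a₁` ignore `x i`. Only the tree is
      -- restricted; `g` stays the same throughout the induction.
      set a₀ : Cube n → ℝ := fun x =>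
        if t₀.eval (override (Function.update π i (some false)) x) then 1 else 0 with ha₀
      set a₁ : Cube n → ℝ := fun x =>
        if t₁.eval (override (Function.update π i (some true)) x) then 1 else 0 with ha₁
      have hev : ∀ x, (if (DecisionTree.query i t₀ t₁).eval (override π x) then (1 : ℝ) else 0)
          = if x i then a₁ x else a₀ x := fun x => by
        rw [DecisionTree.eval, override_apply_none hπ, override_eq_update hπ x]
        cases hx : x i <;> simp [ha₀, ha₁]
      have f₀ : ∀ x, a₀ (flipBit x i) = a₀ x := fun x => by
        simp only [ha₀, override_update_flipBit]
      have f₁ : ∀ x, a₁ (flipBit x i) = a₁ x := fun x => by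
        simp only [ha₁, override_update_flipBit]
      have b₀ : ∀ x, 0 ≤ a₀ x ∧ a₀ x ≤ 1 := fun x => by
        simp only [ha₀]; split_ifs <;> norm_num
      have b₁ : ∀ x, 0 ≤ a₁ x ∧ a₁ x ≤ 1 := fun x => by
        simp only [ha₁]; split_ifs <;> norm_num
      simp only [hev]
      rw [expect_ite_bit i a₀ a₁ f₀ f₁]
      -- Pair `x` with its flip. On a pair with values `g`, `g'` of `g` at `x i = 0`, `x i = 1`, one
      -- has `a₀ g + a₁ g' = (a₀ + a₁)(g + g')/2 + (a₁ - a₀)(g' - g)/2`, and `|a₁ - a₀| ≤ 1`.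
      -- Halving for the average over the pair turns `1/2` into `1/4`.
      have key : expect (fun x => (if x i then a₁ x else a₀ x) * g x)
          ≤ (expect (fun x => a₀ x * g x) + expect (fun x => a₁ x * g x)) / 2
            + 1 / 4 * expect (fun x => |g x - g (flipBit x i)|) := by
        have e1 := expect_flipBit (fun x => (if x i then a₁ x else a₀ x) * g x) i
        have e2 := expect_flipBit (fun x => a₀ x * g x) i
        have e3 := expect_flipBit (fun x => a₁ x * g x) i
        have e4 : expect (fun x => (if x i then a₁ x else a₀ x) * g x
              + (if flipBit x i i then a₁ (flipBit x i) else a₀ (flipBit x i)) * g (flipBit x i))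
            ≤ expect (fun x => 1 / 2 * ((a₀ x * g x + a₀ (flipBit x i) * g (flipBit x i))
              + (a₁ x * g x + a₁ (flipBit x i) * g (flipBit x i)))
              + 1 / 2 * |g x - g (flipBit x i)|) := by
          refine expect_mono fun x => ?_
          have hd : |(a₁ x - a₀ x) * (g x - g (flipBit x i))| ≤ 1 * |g x - g (flipBit x i)| := by
            rw [abs_mul]
            gcongr
            rw [abs_le]
            constructor <;> linarith [b₀ x, b₁ x]
          have := abs_le.1 hd
          rw [f₀, f₁, flipBit_same]
          cases hx : x i <;> simp <;> nlinarith
        simp only [expect_add, expect_const_mul] at e4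
        linarith
      have hs : ∑ j, queryProb (.query i t₀ t₁) π j * expect (fun x => |g x - g (flipBit x j)|)
          = expect (fun x => |g x - g (flipBit x i)|)
            + (∑ j, queryProb t₀ (Function.update π i (some false)) j
                * expect (fun x => |g x - g (flipBit x j)|)
              + ∑ j, queryProb t₁ (Function.update π i (some true)) j
                * expect (fun x => |g x - g (flipBit x j)|)) / 2 := by
        simp only [queryProb_query_none hπ, add_mul, Finset.sum_add_distrib, ite_mul, one_mul,
          zero_mul, Finset.sum_ite_eq', Finset.mem_univ, if_true, add_div, div_mul_eq_mul_div,
          ← Finset.sum_div]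
      rw [hs]
      linarith

lemma dist_true (f : Cube n → Bool) :
    dist f (fun _ => true) = 1 - dist f (fun _ => false) := by
  rw [dist, dist, prob_eq_expect, prob_eq_expect, ← expect_const (n := n) 1, ← expect_sub,
    expect_const]
  congr 1
  funext x
  cases f x <;> simp

/-- A tree computing `f` bounds the bias of every restriction of `f`. -/
lemma bias_restrict_le (T : DecisionTree n) (π : Restriction n) :
    bias (restrict T.eval π) ≤ ∑ j, queryProb T π j * influence (restrict T.eval π) j := by
  set g : Cube n → ℝ := fun x => if T.eval (override π x) then 1 else 0 with hg
  have h := covariance_le T π g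
  have hinf : ∀ j, expect (fun x => |g x - g (flipBit x j)|) = influence (restrict T.eval π) j := by
    intro j
    rw [influence, prob_eq_expect]
    congr 1
    funext x
    simp only [hg, restrict_apply]
    by_cases h₁ : T.eval (override π x) <;> by_cases h₂ : T.eval (override π (flipBit x j)) <;>
      simp [h₁, h₂]
  have hsq : (fun x => (if T.eval (override π x) then 1 else 0) * g x) = g := by
    funext x
    simp only [hg]
    split_ifs <;> simp
  have hp : dist (restrict T.eval π) (fun _ => false) = expect g := by
    rw [dist, prob_eq_expect]
    congr 1
    funext x
    simp [hg, restrict_apply]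
  simp only [hinf] at h
  rw [hsq, ← hg] at h
  have p0 : 0 ≤ expect g := hp ▸ prob_nonneg _
  have p1 : expect g ≤ 1 := hp ▸ prob_le_one _
  rw [bias, dist_true, hp]
  -- With `p = expect g`, the covariance of `g` with itself is `p(1 - p)`, and `min(p, 1 - p) ≤ 2p(1
  -- - p)`. A factor of two is given away.
  rcases le_total (expect g) (1 / 2) with hle | hle
  · exact (min_le_left _ _).trans (by nlinarith)
  · exact (min_le_right _ _).trans (by nlinarith)


/-! ### Runs of online algorithms -/

lemma investment_cons (β : ℝ) (h : History n) (j i : Fin n) (e : Option Bool) :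
    investment β ((j, e) :: h) i = investment β h i + if j = i then β else 0 := by
  by_cases hj : j = i <;> simp [investment, hj, mul_add]

lemma investment_nonneg {β : ℝ} (hβ : 0 ≤ β) (h : History n) (i : Fin n) :
    0 ≤ investment β h i := by
  unfold investment; positivity

lemma sum_investment (β : ℝ) (h : History n) : ∑ i, investment β h i = β * h.length := by
  induction h with
  | nil => simp [investment]
  | cons e h ih =>
    obtain ⟨j, e⟩ := e
    simp only [investment_cons, Finset.sum_add_distrib, ih, Finset.sum_ite_eq, Finset.mem_univ,
      if_true, List.length_cons]
    push_cast
    ring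

variable {A : OnlineAlg n} {β : ℝ} {c : Fin n → ℝ} {x : Cube n}

lemma run_succ_of_inl {t : ℕ} {i : Fin n} (h : A (run A β c x t) = .inl i) :
    run A β c x (t + 1) = (i, feedback β c x (run A β c x t) i) :: run A β c x t := by
  rw [run, h]

lemma run_succ_of_inr {t : ℕ} {b : Bool} (h : A (run A β c x t) = .inr b) :
    run A β c x (t + 1) = run A β c x t := by
  rw [run, h]

/-- A property of histories preserved by every investment holds along the run. -/
lemma run_induction {P : History n → Prop} (h0 : P [])
    (hstep : ∀ t i, A (run A β c x t) = .inl i → P (run A β c x t) →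
      P ((i, feedback β c x (run A β c x t) i) :: run A β c x t)) (t : ℕ) :
    P (run A β c x t) := by
  induction t with
  | zero => exact h0
  | succ t ih =>
    cases hA : A (run A β c x t) with
    | inl i => rw [run_succ_of_inl hA]; exact hstep t i hA ih
    | inr b => rw [run_succ_of_inr hA]; exact ih

lemma run_eq_of_halted {t s : ℕ} {b : Bool} (h : A (run A β c x t) = .inr b) (hs : t ≤ s) :
    run A β c x s = run A β c x t := by
  induction s, hs using Nat.le_induction with
  | base => rfl
  | succ s _ ih => rw [run_succ_of_inr (b := b) (by rw [ih, h]), ih]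

lemma investment_run_mono (hβ : 0 ≤ β) (i : Fin n) :
    Monotone fun t => investment β (run A β c x t) i := by
  refine monotone_nat_of_le_succ fun t => ?_
  cases hA : A (run A β c x t) with
  | inl j =>
    rw [run_succ_of_inl hA, investment_cons]
    split_ifs <;> linarith
  | inr b => rw [run_succ_of_inr hA]

lemma eq_finalHistory {t : ℕ} {b : Bool} (h : A (run A β c x t) = .inr b) :
    run A β c x t = finalHistory A β c x := by
  classical
  have H : Halts A β c x := ⟨t, b, h⟩
  obtain ⟨b', hb'⟩ := Nat.find_spec H
  rw [finalHistory, dif_pos H]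
  exact run_eq_of_halted hb' (Nat.find_min' H ⟨b, h⟩)

/-- A common number of steps after which the algorithm has halted on all inputs. -/
lemma exists_steps (H : ∀ x, Halts A β c x) :
    ∃ N, ∀ x, run A β c x N = finalHistory A β c x ∧
      A (run A β c x N) = .inr (onlineOutput A β c x) := by
  choose t b hb using H
  -- The sum of all halting times dominates each of them, and runs are constant after halting.
  refine ⟨∑ x, t x, fun x => ?_⟩
  have h := run_eq_of_halted (hb x)
    (Finset.single_le_sum (f := t) (fun _ _ => Nat.zero_le _) (Finset.mem_univ x))
  have hf := eq_finalHistory (hb x)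
  refine ⟨h.trans hf, ?_⟩
  rw [h, onlineOutput, ← hf, hb x]

/-! ### Exact decision trees from exact algorithms -/

open Classical in
/-- The decision tree that simulates the online algorithm `A` from the history `h` on for the
given number of steps. -/
noncomputable def simulate (A : OnlineAlg n) (β : ℝ) (c : Fin n → ℝ) :
    ℕ → History n → DecisionTree n
  | 0, _ => .leaf false
  | t + 1, h =>
    match A h with
    | .inr b => .leaf b
    | .inl i =>
      if c i ≤ investment β h i + β then
        .query i (simulate A β c t ((i, some false) :: h)) (simulate A β c t ((i, some true) :: h))
      else simulate A β c t ((i, none) :: h)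

/-- A bit is queried only when the investment has reached its price, and investments never decrease;
so the tree costs at most what the online algorithm spends. The extra unit in `t + 1` is consumed by
the leaf at the moment of halting. -/
lemma simulate_run (hβ : 0 ≤ β) {b : Bool} (t s : ℕ) (hs : A (run A β c x (s + t)) = .inr b) :
    (simulate A β c (t + 1) (run A β c x s)).eval x = b ∧
      ∀ i ∈ (simulate A β c (t + 1) (run A β c x s)).queried x,
        c i ≤ investment β (run A β c x (s + t)) i := by
  induction t generalizing s with
  | zero =>
    rw [add_zero] at hs
    simp [simulate, hs, DecisionTree.eval, DecisionTree.queried]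
  | succ t ih =>
    cases hA : A (run A β c x s) with
    | inr b' =>
      rw [run_eq_of_halted hA (Nat.le_add_right _ _), hA] at hs
      rw [simulate, hA]
      simpa [DecisionTree.eval, DecisionTree.queried] using hs
    | inl i =>
      have e : s + (t + 1) = s + 1 + t := by ring
      rw [e] at hs ⊢
      have ih' := ih (s + 1) hs
      rw [run_succ_of_inl hA] at ih'
      rw [simulate, hA]
      by_cases hc : c i ≤ investment β (run A β c x s) i + β
      · have hi : c i ≤ investment β (run A β c x (s + 1 + t)) i := by
          refine le_trans ?_ (investment_run_mono hβ i (Nat.le_add_right (s + 1) t))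
          simpa [run_succ_of_inl hA, investment_cons] using hc
        simp only [feedback, hc, if_true] at ih'
        simp only [hc, if_true, DecisionTree.eval, DecisionTree.queried, Finset.mem_insert,
          forall_eq_or_imp]
        cases hx : x i <;> rw [hx] at ih' <;> simp only [Bool.false_eq_true, if_true, if_false] <;>
          exact ⟨ih'.1, hi, ih'.2⟩
      · simp only [feedback, hc, if_false] at ih' ⊢
        exact ih'

/-- Inducting on a set of relevant variables works because fixing the value of one of them leaves a
function of the others. -/
lemma exists_tree_of_dependsOn (s : Finset (Fin n)) (f : Cube n → Bool)
    (hf : ∀ x y : Cube n, (∀ i ∈ s, x i = y i) → f x = f y) :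
    ∃ T : DecisionTree n, T.eval = f := by
  induction s using Finset.induction_on generalizing f with
  | empty =>
    exact ⟨.leaf (f fun _ => false), funext fun x => hf _ _ (by simp)⟩
  | insert i s _ ih =>
    have hb : ∀ b, ∃ T : DecisionTree n, T.eval = fun x => f (Function.update x i b) := fun b => by
      refine ih _ fun x y hxy => hf _ _ fun j hj => ?_
      by_cases hji : j = i
      · subst hji; simp
      · simpa [hji] using hxy j (Finset.mem_of_mem_insert_of_ne hj hji)
    obtain ⟨T₀, h₀⟩ := hb false
    obtain ⟨T₁, h₁⟩ := hb true
    refine ⟨.query i T₀ T₁, funext fun x => ?_⟩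
    rw [DecisionTree.eval, h₀, h₁]
    cases hx : x i <;> simp [← hx]

/-- A lower bound for the worst-case costs of exact decision trees is a lower bound for the
zero-error benchmark. -/
lemma le_optWorst_zero {f : Cube n → Bool} {a : ℝ}
    (h : ∀ (T : DecisionTree n) (w : ℝ), T.eval = f → (∀ x, T.cost c x ≤ w) → a ≤ w) :
    a ≤ optWorst 0 f c := by
  refine le_csInf ?_ ?_
  · obtain ⟨T, hT⟩ := exists_tree_of_dependsOn Finset.univ f
      fun x y hxy => by rw [funext fun i => hxy i (Finset.mem_univ i)]
    exact ⟨_, Or.inl ⟨T, by simp [hT, dist, prob], rfl⟩⟩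
  · rintro w (⟨T, hT, rfl⟩ | ⟨β, B, hβ, ⟨hH, hB⟩, rfl⟩)
    · exact h T _ (eq_of_dist_nonpos hT).symm fun x => le_ciSup (Set.finite_range _).bddAbove x
    · obtain ⟨N, hN⟩ := exists_steps hH
      have hsim := fun x => simulate_run (x := x) hβ.le (b := onlineOutput B β c x) N 0
        (by rw [zero_add]; exact (hN x).2)
      refine h (simulate B β c (N + 1) []) _ ?_ fun x => ?_
      · rw [eq_of_dist_nonpos hB]
        exact funext fun x => (hsim x).1
      · refine le_trans ?_ (le_ciSup (Set.finite_range _).bddAbove x)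
        rw [onlineCost, DecisionTree.cost, ← (hN x).1]
        refine (Finset.sum_le_sum fun i hi => ?_).trans (Finset.sum_le_sum_of_subset_of_nonneg
          (Finset.subset_univ _) fun i _ _ => investment_nonneg hβ.le _ i)
        simpa using (hsim x).2 i hi

/-! ### Information revealed along a run -/

lemma revealed_cons_ne_none {h : History n} {i : Fin n} (e : Fin n × Option Bool)
    (hi : revealed h i ≠ none) : revealed (e :: h) i ≠ none := by
  obtain ⟨j, _ | b⟩ := e
  · exact hi
  · by_cases hj : i = j
    · subst hj; simp [revealed]
    · simpa [revealed, hj] using hi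

lemma revealed_run_some {t : ℕ} {i : Fin n} {b : Bool}
    (h : revealed (run A β c x t) i = some b) : x i = b := by
  revert i b
  refine run_induction (P := fun h => ∀ {i b}, revealed h i = some b → x i = b) ?_ ?_ t
  · simp [revealed]
  · intro t j _ ih i b h
    by_cases hc : c j ≤ investment β (run A β c x t) j + β
    · simp only [feedback, hc, if_true, revealed] at h
      by_cases hj : i = j
      · subst hj; simpa using h
      · exact ih (by simpa [hj] using h)
    · simp only [feedback, hc, if_false, revealed] at h
      exact ih h

/-- An investment reaching `c i` would have revealed the bit. The inequality is not strict because a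
variable of price `0` is still hidden before the first investment in it. -/
lemma investment_run_le_of_free (hc : ∀ i, 0 ≤ c i) {t : ℕ} {i : Fin n}
    (h : revealed (run A β c x t) i = none) : investment β (run A β c x t) i ≤ c i := by
  revert h
  refine run_induction (P := fun h => revealed h i = none → investment β h i ≤ c i) ?_ ?_ t
  · intro _
    simpa [investment] using hc i
  · intro t j _ ih h
    have h' : revealed (run A β c x t) i = none := by
      by_contra h'
      exact revealed_cons_ne_none _ h' h
    rw [investment_cons]
    split_ifs with hj
    · subst hj
      by_contra! hlt
      simp [feedback, hlt.le, revealed] at h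
    · simpa using ih h'

/-- The algorithm sees the input only through revealed bits, so inputs agreeing on those produce the
same history. -/
lemma run_congr {y : Cube n} {t : ℕ}
    (h : ∀ i, revealed (run A β c x t) i ≠ none → y i = x i) :
    run A β c y t = run A β c x t := by
  induction t with
  | zero => rfl
  | succ t ih =>
    cases hA : A (run A β c x t) with
    | inr b =>
      rw [run_succ_of_inr hA] at h ⊢
      rw [run_succ_of_inr (b := b) (by rw [ih h, hA]), ih h]
    | inl i =>
      rw [run_succ_of_inl hA] at h ⊢
      have ih' := ih fun j hj => h j (revealed_cons_ne_none _ hj)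
      rw [run_succ_of_inl (i := i) (by rw [ih', hA]), ih']
      by_cases hc : c i ≤ investment β (run A β c x t) i + β
      · have := h i (by simp [feedback, hc, revealed])
        simp [feedback, this]
      · simp [feedback, hc]

lemma run_override (t : ℕ) (y : Cube n) :
    run A β c (override (revealed (run A β c x t)) y) t = run A β c x t := by
  refine run_congr fun i hi => ?_
  obtain ⟨b, hb⟩ := Option.ne_none_iff_exists'.1 hi
  rw [override_apply_some hb, revealed_run_some hb]

/-- Resampling the variables that are left free by an adaptively chosen restriction does not change
an expectation. -/
lemma expect_resample (ρ : Cube n → Restriction n)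
    (hρ : ∀ x i b, ρ x i = some b → x i = b) (hs : ∀ x y, ρ (override (ρ x) y) = ρ x)
    (F : Cube n → ℝ) :
    expect F = expect fun x => expect fun y => F (override (ρ x) y) := by
  -- `σ` exchanges the coordinates of `x` and `y` left free by `ρ x`. By `hs` the exchange does not
  -- change `ρ`, so `σ` is an involution and preserves the uniform measure on pairs.
  let σ : Cube n × Cube n → Cube n × Cube n := fun p =>
    (override (ρ p.1) p.2, fun i => if ρ p.1 i = none then p.1 i else p.2 i)
  have hσ : Function.Involutive σ := by
    rintro ⟨x, y⟩
    simp only [σ, hs, Prod.mk.injEq]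
    constructor <;> funext i <;> cases hi : ρ x i <;> simp [override, hi]
    exact (hρ x i _ hi).symm
  have h1 : ∑ p : Cube n × Cube n, F (σ p).1 = ∑ p : Cube n × Cube n, F p.1 :=
    Function.Bijective.sum_comp hσ.bijective fun p => F p.1
  rw [Fintype.sum_prod_type, Fintype.sum_prod_type] at h1
  calc expect F = expect fun x => expect fun _ : Cube n => F x := by simp only [expect_const]
    _ = expect fun x => expect fun y => F (override (ρ x) y) := by
      simp only [expect, ← Finset.sum_div]
      rw [← h1]

lemma expect_resample_run (A : OnlineAlg n) (β : ℝ) (c : Fin n → ℝ) (t : ℕ) (F : Cube n → ℝ) :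
    expect F = expect fun x => expect fun y => F (override (revealed (run A β c x t)) y) :=
  expect_resample (fun x => revealed (run A β c x t)) (fun _ _ _ h => revealed_run_some h)
    (fun x y => by rw [run_override]) F


/-! ### Influences under random restrictions -/

lemma override_flipBit {π : Restriction n} {i : Fin n} (h : π i = none) (x : Cube n) :
    override π (flipBit x i) = flipBit (override π x) i := by
  funext j
  by_cases hj : j = i
  · subst hj; simp [override, h]
  · simp [override, flipBit_of_ne _ hj]

lemma override_flipBit_of_ne_none {π : Restriction n} {i : Fin n} (h : π i ≠ none) (x : Cube n) :
    override π (flipBit x i) = override π x := by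
  obtain ⟨b, hb⟩ := Option.ne_none_iff_exists'.1 h
  funext j
  by_cases hj : j = i
  · subst hj; simp [override, hb]
  · simp [override, flipBit_of_ne _ hj]

lemma influence_restrict_of_ne_none (f : Cube n → Bool) {π : Restriction n} {i : Fin n}
    (h : π i ≠ none) : influence (restrict f π) i = 0 := by
  simp [influence, prob, restrict_apply, override_flipBit_of_ne_none h]

lemma influence_restrict_of_eq_none (f : Cube n → Bool) {π : Restriction n} {i : Fin n}
    (h : π i = none) : influence (restrict f π) i =
      expect fun x => if f (override π x) ≠ f (flipBit (override π x) i) then (1 : ℝ) else 0 := by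
  rw [influence, prob_eq_expect]
  simp only [restrict_apply, override_flipBit h]

lemma influence_pos_of_restrict {f : Cube n → Bool} {π : Restriction n} {i : Fin n}
    (h : 0 < influence (restrict f π) i) : 0 < influence f i := by
  by_cases hi : π i = none
  · obtain ⟨x, hx⟩ := exists_of_prob_pos h
    rw [restrict_apply, restrict_apply, override_flipBit hi] at hx
    exact prob_pos (P := fun x => f x ≠ f (flipBit x i)) hx
  · exact absurd h (by rw [influence_restrict_of_ne_none f hi]; exact lt_irrefl _)

/-- Fixing a random bit does not increase an influence on average. -/
lemma influence_restrict_update_add_le (f : Cube n → Bool) {π : Restriction n} {j : Fin n}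
    (hj : π j = none) (i : Fin n) :
    influence (restrict f (Function.update π j (some false))) i
      + influence (restrict f (Function.update π j (some true))) i
      ≤ 2 * influence (restrict f π) i := by
  -- Revealing `i` itself destroys its influence; this is the only case in which equality can fail.
  by_cases hij : i = j
  · subst hij
    rw [influence_restrict_of_ne_none f (by simp), influence_restrict_of_ne_none f (by simp)]
    linarith [influence_nonneg (restrict f π) i]
  · by_cases hi : π i = none
    · rw [influence_restrict_of_eq_none f hi, influence_restrict_of_eq_none f (by simpa [hij] using hi),
        influence_restrict_of_eq_none f (by simpa [hij] using hi),
        expect_override hj fun z => if f z ≠ f (flipBit z i) then (1 : ℝ) else 0]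
      linarith
    · rw [influence_restrict_of_ne_none f hi, influence_restrict_of_ne_none f (by simpa [hij] using hi),
        influence_restrict_of_ne_none f (by simpa [hij] using hi)]
      norm_num

/-! ### A maximal inequality along the run -/

/-- The largest influence that variable `i` has had along the history `h`. -/
noncomputable def maxInfluence (f : Cube n → Bool) (i : Fin n) : History n → ℝ
  | [] => influence f i
  | e :: h => max (maxInfluence f i h) (influence (restrict f (revealed (e :: h))) i)

lemma influence_le_maxInfluence (f : Cube n → Bool) (i : Fin n) (h : History n) :
    influence (restrict f (revealed h)) i ≤ maxInfluence f i h := by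
  cases h with
  | nil => exact le_rfl
  | cons e h => exact le_max_right _ _

lemma maxInfluence_nonneg (f : Cube n → Bool) (i : Fin n) (h : History n) :
    0 ≤ maxInfluence f i h :=
  (influence_nonneg _ _).trans (influence_le_maxInfluence f i h)

lemma maxInfluence_cons_eq {f : Cube n → Bool} {e : Fin n × Option Bool} {h : History n}
    (he : revealed (e :: h) = revealed h) (i : Fin n) :
    maxInfluence f i (e :: h) = maxInfluence f i h := by
  rw [maxInfluence, he, max_eq_left (influence_le_maxInfluence f i h)]

/-- For a nonnegative martingale with running maximum `m` and current value `v`, an upper bound for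
the expectation of the final running maximum truncated at `s`. -/
noncomputable def maxPotential (s m v : ℝ) : ℝ :=
  min s m + v * Real.log (s / min s m)

lemma log_div_min_nonneg {s m : ℝ} (hs : 0 < s) (hm : 0 ≤ m) : 0 ≤ Real.log (s / min s m) := by
  rcases hm.eq_or_lt with rfl | hm
  · simp [hs.le]
  · exact Real.log_nonneg ((one_le_div (lt_min hs hm)).2 (min_le_left _ _))

/-- Updating the maximum after the value has moved to `v` does not raise the potential: if `min s m`
grows from `a` to `a' ≤ v`, the logarithmic term drops by `v ln(a'/a) ≥ a'(1 - a/a') = a' - a`. The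
remaining bound is affine in `v`, which is what averaging over a random bit needs. -/
lemma maxPotential_max_le {s m v : ℝ} (hs : 0 < s) (hm : 0 < m) :
    maxPotential s (max m v) v ≤ min s m + v * Real.log (s / min s m) := by
  unfold maxPotential
  rcases le_total v m with h | h
  · rw [max_eq_left h]
  rw [max_eq_right h]
  have hv : 0 < v := hm.trans_le h
  set a := min s m
  set a' := min s v
  have ha : 0 < a := lt_min hs hm
  have ha' : 0 < a' := lt_min hs hv
  have haa : a ≤ a' := min_le_min_left s h
  have h1 : Real.log (s / a) = Real.log (s / a') + Real.log (a' / a) := by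
    rw [← Real.log_mul (by positivity) (by positivity)]
    congr 1
    field_simp
  have h2 : 1 - a / a' ≤ Real.log (a' / a) := by
    have := Real.one_sub_inv_le_log_of_pos (x := a' / a) (by positivity)
    rwa [inv_div] at this
  have h3 : a' - a ≤ v * Real.log (a' / a) := by
    have h4 : a' * (1 - a / a') = a' - a := by field_simp
    have h5 : 0 ≤ Real.log (a' / a) := Real.log_nonneg ((one_le_div ha).2 haa)
    have h6 : a' ≤ v := min_le_right _ _
    nlinarith
  rw [h1]
  linarith

/-- The potential of variable `i` after the history `h`. -/
noncomputable def historyPotential (f : Cube n → Bool) (s : ℝ) (i : Fin n) (h : History n) : ℝ :=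
  maxPotential s (maxInfluence f i h) (influence (restrict f (revealed h)) i)

lemma historyPotential_cons_eq {f : Cube n → Bool} {e : Fin n × Option Bool} {h : History n}
    (he : revealed (e :: h) = revealed h) (s : ℝ) (i : Fin n) :
    historyPotential f s i (e :: h) = historyPotential f s i h := by
  rw [historyPotential, historyPotential, maxInfluence_cons_eq he, he]

lemma historyPotential_reveal_le (f : Cube n → Bool) {s : ℝ} (hs : 0 < s) (i : Fin n)
    {h : History n} {j : Fin n} (hj : revealed h j = none) :
    (historyPotential f s i ((j, some false) :: h) + historyPotential f s i ((j, some true) :: h)) / 2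
      ≤ historyPotential f s i h := by
  have hsum := influence_restrict_update_add_le f hj i
  have hv := influence_le_maxInfluence f i h
  simp only [historyPotential, maxInfluence, revealed]
  have n₀ := influence_nonneg (restrict f (Function.update (revealed h) j (some false))) i
  have n₁ := influence_nonneg (restrict f (Function.update (revealed h) j (some true))) i
  generalize influence (restrict f (Function.update (revealed h) j (some false))) i = v₀ at *
  generalize influence (restrict f (Function.update (revealed h) j (some true))) i = v₁ at *
  have nv := influence_nonneg (restrict f (revealed h)) i
  generalize influence (restrict f (revealed h)) i = v at *
  have hm := maxInfluence_nonneg f i h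
  generalize maxInfluence f i h = m at *
  -- If the maximum is zero, all the influences involved vanish; this case is separate because
  -- `maxPotential_max_le` needs `m > 0`.
  rcases hm.eq_or_lt with rfl | hm'
  · obtain rfl : v = 0 := le_antisymm hv nv
    obtain rfl : v₀ = 0 := by linarith
    obtain rfl : v₁ = 0 := by linarith
    simp
  · have h₀ := maxPotential_max_le (v := v₀) hs hm'
    have h₁ := maxPotential_max_le (v := v₁) hs hm'
    have hl := log_div_min_nonneg hs hm
    unfold maxPotential at *
    nlinarith

variable {A : OnlineAlg n} {β : ℝ} {c : Fin n → ℝ}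

lemma expect_historyPotential_succ_le (f : Cube n → Bool) {s : ℝ} (hs : 0 < s) (i : Fin n)
    (t : ℕ) :
    expect (fun x => historyPotential f s i (run A β c x (t + 1)))
      ≤ expect (fun x => historyPotential f s i (run A β c x t)) := by
  -- Condition on the history at time `t`; the bits still hidden are then uniform.
  rw [expect_resample_run A β c t]
  refine expect_mono fun x => ?_
  set h := run A β c x t with hh
  have hrun : ∀ y, run A β c (override (revealed h) y) t = h := fun y => run_override t y
  cases hA : A h with
  | inr b =>
    have : ∀ y, run A β c (override (revealed h) y) (t + 1) = h := fun y => by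
      rw [run_succ_of_inr (b := b) (by rw [hrun, hA]), hrun]
    simp only [this, expect_const, le_refl]
  | inl j =>
    have hstep : ∀ y, run A β c (override (revealed h) y) (t + 1)
        = (j, feedback β c (override (revealed h) y) h j) :: h := fun y => by
      rw [run_succ_of_inl (i := j) (by rw [hrun, hA]), hrun]
    simp only [hstep]
    by_cases hc : c j ≤ investment β h j + β
    · simp only [feedback, hc, if_true]
      cases hj : revealed h j with
      -- Investing in a variable that is already known reveals the same bit again and leaves the
      -- restriction unchanged.
      | some b =>
        have he : revealed ((j, some b) :: h) = revealed h := by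
          rw [revealed, ← hj, Function.update_eq_self]
        simp only [override_apply_some hj, historyPotential_cons_eq he, expect_const, le_refl]
      | none =>
        refine le_trans (le_of_eq ?_) (historyPotential_reveal_le f hs i hj)
        rw [← expect_const (n := n) (historyPotential f s i ((j, some false) :: h)),
          ← expect_const (n := n) (historyPotential f s i ((j, some true) :: h)),
          ← expect_ite_bit j _ _ (fun _ => rfl) (fun _ => rfl)]
        congr 1
        funext y
        rw [override_apply_none hj]
        cases y j <;> rfl
    · simp only [feedback, hc, if_false, historyPotential_cons_eq (e := (j, none)) rfl,
        expect_const, le_refl]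

/-- The expected truncated maximum of the influence of a variable along a run. -/
lemma expect_min_maxInfluence_le (f : Cube n → Bool) {s : ℝ} (hs : 0 < s) (i : Fin n) (t : ℕ) :
    expect (fun x => min s (maxInfluence f i (run A β c x t)))
      ≤ maxPotential s (influence f i) (influence f i) := by
  have h : expect (fun x => historyPotential f s i (run A β c x t))
      ≤ maxPotential s (influence f i) (influence f i) := by
    induction t with
    | zero => exact (expect_const (n := n) (historyPotential f s i [])).le
    | succ t ih => exact (expect_historyPotential_succ_le f hs i t).trans ih
  refine (expect_mono fun x => ?_).trans h
  exact le_add_of_nonneg_right (mul_nonneg (influence_nonneg _ _)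
    (log_div_min_nonneg hs (maxInfluence_nonneg _ _ _)))


/-! ### Analysis of the algorithm -/

/-- This is `bias_restrict_le` for the empty restriction, with query probabilities bounded by one.
It guarantees that the algorithm has a variable to choose, and later absorbs an additive `ε` into
the total influence. -/
lemma bias_le_totalInfluence (f : Cube n → Bool) : bias f ≤ totalInfluence f := by
  obtain ⟨T, rfl⟩ := exists_tree_of_dependsOn Finset.univ f
    fun x y hxy => by rw [funext fun i => hxy i (Finset.mem_univ i)]
  refine (bias_restrict_le T fun _ => none).trans (Finset.sum_le_sum fun j _ => ?_)
  exact mul_le_of_le_one_left (influence_nonneg _ _) (queryProb_le_one _ _ _)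

lemma exists_isWarmupIPRR (f : Cube n → Bool) {ε : ℝ} (β : ℝ) (hε : 0 < ε) :
    ∃ A : OnlineAlg n, IsWarmupIPRR f ε β A := by
  classical
  have key : ∀ h : History n, ∃ a : Fin n ⊕ Bool,
      (ε < bias (restrict f (revealed h)) →
        ∃ i, a = .inl i ∧ ∀ j, influenceRatio f β h j ≤ influenceRatio f β h i) ∧
      (bias (restrict f (revealed h)) ≤ ε →
        a = .inr (decide (1 / 2 ≤ prob fun x => restrict f (revealed h) x = true))) := by
    intro h
    rcases lt_or_ge ε (bias (restrict f (revealed h))) with hb | hb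
    · rcases isEmpty_or_nonempty (Fin n) with hn | hn
      · exfalso
        exact (hε.trans hb).not_ge ((bias_le_totalInfluence _).trans (by simp [totalInfluence]))
      · obtain ⟨i, hi⟩ := Finite.exists_max (influenceRatio f β h)
        exact ⟨.inl i, fun _ => ⟨i, rfl, hi⟩, fun h' => absurd h' hb.not_ge⟩
    · exact ⟨_, fun h' => absurd h' hb.not_gt, fun _ => rfl⟩
  choose A hA using key
  exact ⟨A, hA⟩

lemma dist_majority (g : Cube n → Bool) [Decidable (1 / 2 ≤ prob fun x => g x = true)] :
    dist g (fun _ => decide (1 / 2 ≤ prob fun x => g x = true)) = bias g := by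
  have h0 : dist g (fun _ => false) = prob fun x => g x = true := by
    simp [dist, prob]
  rw [bias, dist_true, h0]
  by_cases h : 1 / 2 ≤ prob fun x => g x = true
  · simp only [h, decide_true]
    rw [dist_true, h0, min_eq_right (by linarith)]
  · simp only [h, decide_false]
    rw [h0, min_eq_left (by linarith)]

/-- The greedy rule in cross-multiplied form, which remains valid under the conventions for zero
investments. -/
lemma influence_mul_investment_le {f : Cube n → Bool} {β : ℝ} (hβ : 0 ≤ β) {h : History n}
    {i j : Fin n} (hij : influenceRatio f β h j ≤ influenceRatio f β h i) :
    influence (restrict f (revealed h)) j * investment β h i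
      ≤ influence (restrict f (revealed h)) i * investment β h j := by
  unfold influenceRatio at hij
  have ai := influence_nonneg (restrict f (revealed h)) i
  have aj := influence_nonneg (restrict f (revealed h)) j
  have ti := investment_nonneg hβ h i
  have tj := investment_nonneg hβ h j
  generalize influence (restrict f (revealed h)) i = a at *
  generalize influence (restrict f (revealed h)) j = b at *
  generalize investment β h i = u at *
  generalize investment β h j = v at *
  rcases ti.eq_or_lt with rfl | hu
  · simpa using mul_nonneg ai tj
  rw [← ENNReal.ofReal_div_of_pos hu] at hij
  rcases tj.eq_or_lt with rfl | hv
  · rcases aj.eq_or_lt with rfl | hb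
    · simp
    · rw [ENNReal.ofReal_zero, ENNReal.div_zero (by simpa using hb)] at hij
      exact absurd hij (by simp)
  · rw [← ENNReal.ofReal_div_of_pos hv, ENNReal.ofReal_le_ofReal_iff (by positivity),
      div_le_div_iff₀ hv hu] at hij
    exact hij

lemma mem_queried_of_ne {T : DecisionTree n} {x : Cube n} {i : Fin n}
    (h : T.eval x ≠ T.eval (flipBit x i)) : i ∈ T.queried x := by
  induction T with
  | leaf b => exact absurd rfl h
  | query j t₀ t₁ ih₀ ih₁ =>
    rw [DecisionTree.queried, Finset.mem_insert]
    by_cases hj : i = j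
    · exact Or.inl hj
    · right
      simp only [DecisionTree.eval, flipBit_of_ne x (Ne.symm hj)] at h
      cases hx : x j
      · exact ih₀ (by simpa [hx] using h)
      · exact ih₁ (by simpa [hx] using h)

lemma sum_queryProb_mul_le {c : Fin n → ℝ} (hc : ∀ i, 0 ≤ c i) {T : DecisionTree n} {w : ℝ}
    (hT : ∀ x, T.cost c x ≤ w) (π : Restriction n) : ∑ j, queryProb T π j * c j ≤ w := by
  calc ∑ j, queryProb T π j * c j
      ≤ ∑ j, expect (fun x => c j * if j ∈ T.queried (override π x) then (1 : ℝ) else 0) := by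
        refine Finset.sum_le_sum fun j _ => ?_
        rw [expect_const_mul, mul_comm]
        refine mul_le_mul_of_nonneg_left ?_ (hc j)
        unfold queryProb
        split_ifs
        · exact le_rfl
        · exact expect_nonneg fun x => by split_ifs <;> norm_num
    _ = expect (fun x => T.cost c (override π x)) := by
        rw [← expect_sum]
        congr 1
        funext x
        simp [DecisionTree.cost]
    _ ≤ w := (expect_mono fun x => hT _).trans_eq (expect_const w)

section Warmup

variable {T : DecisionTree n} {ε β w : ℝ} {A : OnlineAlg n} {c : Fin n → ℝ}

lemma IsWarmupIPRR.lt_bias {f : Cube n → Bool} (hA : IsWarmupIPRR f ε β A) {h : History n}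
    {i : Fin n} (hi : A h = .inl i) : ε < bias (restrict f (revealed h)) := by
  by_contra! hb
  rw [(hA h).2 hb] at hi
  cases hi

lemma IsWarmupIPRR.bias_le {f : Cube n → Bool} (hA : IsWarmupIPRR f ε β A) {h : History n}
    {b : Bool} (hb : A h = .inr b) : bias (restrict f (revealed h)) ≤ ε := by
  by_contra! hlt
  obtain ⟨i, hi, _⟩ := (hA h).1 hlt
  rw [hi] at hb
  cases hb

/-- Before an investment in variable `i`, the amount already invested in it is small. -/
lemma IsWarmupIPRR.investment_le (hA : IsWarmupIPRR T.eval ε β A) (hε : 0 < ε) (hβ : 0 ≤ β)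
    (hc : ∀ i, 0 ≤ c i) (hT : ∀ x, T.cost c x ≤ w) {s : ℝ} (hs : ε ≤ s) {x : Cube n} {t : ℕ}
    {i : Fin n} (hi : A (run A β c x t) = .inl i) :
    investment β (run A β c x t) i
      ≤ w / ε * min s (influence (restrict T.eval (revealed (run A β c x t))) i) := by
  set h := run A β c x t with hh
  have hw : 0 ≤ w := (Finset.sum_nonneg fun i _ => hc i).trans (hT x)
  have hb := hA.lt_bias hi
  have hmax : ∀ j, influenceRatio T.eval β h j ≤ influenceRatio T.eval β h i := by
    obtain ⟨i', hi', hmax⟩ := (hA h).1 hb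
    rw [hi] at hi'
    cases hi'
    exact hmax
  have hθ := investment_nonneg hβ h i
  have hI := influence_nonneg (restrict T.eval (revealed h)) i
  have hmul : ε * investment β h i ≤ influence (restrict T.eval (revealed h)) i * w := by
    calc ε * investment β h i
        ≤ (∑ j, queryProb T (revealed h) j * influence (restrict T.eval (revealed h)) j)
            * investment β h i :=
          mul_le_mul_of_nonneg_right (hb.le.trans (bias_restrict_le T (revealed h))) hθ
      _ = ∑ j, queryProb T (revealed h) j
            * (influence (restrict T.eval (revealed h)) j * investment β h i) := by
          rw [Finset.sum_mul]
          exact Finset.sum_congr rfl fun j _ => by ring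
      _ ≤ ∑ j, influence (restrict T.eval (revealed h)) i * (queryProb T (revealed h) j * c j) := by
          refine Finset.sum_le_sum fun j _ => ?_
          by_cases hj : revealed h j = none
          · have h1 : investment β h j ≤ c j := investment_run_le_of_free hc hj
            calc queryProb T (revealed h) j
                  * (influence (restrict T.eval (revealed h)) j * investment β h i)
                ≤ queryProb T (revealed h) j
                  * (influence (restrict T.eval (revealed h)) i * c j) :=
                  mul_le_mul_of_nonneg_left ((influence_mul_investment_le hβ (hmax j)).trans
                    (mul_le_mul_of_nonneg_left h1 hI)) (queryProb_nonneg _ _ _)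
              _ = _ := by ring
          · simp [queryProb, hj]
      _ ≤ influence (restrict T.eval (revealed h)) i * w := by
          rw [← Finset.mul_sum]
          exact mul_le_mul_of_nonneg_left (sum_queryProb_mul_le hc hT _) hI
  rw [mul_min_of_nonneg _ _ (div_nonneg hw hε.le)]
  refine le_min ?_ ?_
  -- Since `s ≥ ε`, it is enough that the investment is at most `w`. If the influence is positive,
  -- `i` is hidden and `f` is sensitive to it at some `y`, so `T` must pay `c i` on `y`.
  · refine le_trans ?_ (show w ≤ w / ε * s by
      rw [div_mul_eq_mul_div, le_div_iff₀ hε]; exact mul_le_mul_of_nonneg_left hs hw)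
    rcases hI.eq_or_lt with h0 | hpos
    · rw [← h0, zero_mul] at hmul
      nlinarith
    · have hfree : revealed h i = none := by
        by_contra hne
        rw [influence_restrict_of_ne_none _ hne] at hpos
        exact lt_irrefl _ hpos
      obtain ⟨y, hy⟩ := exists_of_prob_pos (influence_pos_of_restrict hpos)
      calc investment β h i ≤ c i := investment_run_le_of_free hc hfree
        _ ≤ T.cost c y := Finset.single_le_sum (fun j _ => hc j) (mem_queried_of_ne hy)
        _ ≤ w := hT y
  · rw [div_mul_eq_mul_div, le_div_iff₀ hε]
    linarith

/-- The bound of `IsWarmupIPRR.investment_le` holds just before each investment, so the last unit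
accounts for the extra `β`. The running maximum keeps the bound valid after the influence drops. -/
lemma IsWarmupIPRR.investment_run_le (hA : IsWarmupIPRR T.eval ε β A) (hε : 0 < ε) (hβ : 0 ≤ β)
    (hc : ∀ i, 0 ≤ c i) (hT : ∀ x, T.cost c x ≤ w) {s : ℝ} (hs : ε ≤ s) (x : Cube n) (t : ℕ)
    (i : Fin n) :
    investment β (run A β c x t) i
      ≤ β + w / ε * min s (maxInfluence T.eval i (run A β c x t)) := by
  have hw : 0 ≤ w / ε := div_nonneg ((Finset.sum_nonneg fun i _ => hc i).trans (hT x)) hε.le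
  refine run_induction
    (P := fun h => investment β h i ≤ β + w / ε * min s (maxInfluence T.eval i h)) ?_ ?_ t
  · have := mul_nonneg hw (le_min (hε.le.trans hs) (maxInfluence_nonneg T.eval i []))
    simp only [investment, List.countP_nil, Nat.cast_zero, mul_zero]
    linarith
  · intro t j hj ih
    have hmono : ∀ e, maxInfluence T.eval i (run A β c x t)
        ≤ maxInfluence T.eval i (e :: run A β c x t) := fun e => le_max_left _ _
    rw [investment_cons]
    split_ifs with hji
    · subst hji
      rw [add_comm]
      refine add_le_add_right ((hA.investment_le hε hβ hc hT hs hj).trans ?_) _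
      exact mul_le_mul_of_nonneg_left (min_le_min_left s
        ((influence_le_maxInfluence _ _ _).trans (hmono _))) hw
    · rw [add_zero]
      exact ih.trans (add_le_add_right (mul_le_mul_of_nonneg_left
        (min_le_min_left s (hmono _)) hw) _)

lemma IsWarmupIPRR.halts (hA : IsWarmupIPRR T.eval ε β A) (hε : 0 < ε) (hβ : 0 < β)
    (hc : ∀ i, 0 ≤ c i) (x : Cube n) : Halts A β c x := by
  by_contra hH
  have hlen : ∀ t, (run A β c x t).length = t := by
    intro t
    induction t with
    | zero => rfl
    | succ t ih =>
      cases hA' : A (run A β c x t) with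
      | inr b => exact absurd ⟨t, b, hA'⟩ hH
      | inl i => rw [run_succ_of_inl hA', List.length_cons, ih]
  -- Any finite bound on the cost of `T` will do: each step before halting adds `β` to the total
  -- investment, which stays bounded.
  set w := ∑ i, c i
  have hT : ∀ x, T.cost c x ≤ w := fun x =>
    Finset.sum_le_sum_of_subset_of_nonneg (Finset.subset_univ _) fun i _ _ => hc i
  have hw : 0 ≤ w / ε := div_nonneg (Finset.sum_nonneg fun i _ => hc i) hε.le
  obtain ⟨t, ht⟩ := exists_nat_gt ((∑ _i : Fin n, (β + w / ε * ε)) / β)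
  rw [div_lt_iff₀ hβ] at ht
  have hsum := sum_investment β (run A β c x t)
  have hle : ∑ i, investment β (run A β c x t) i ≤ ∑ _i : Fin n, (β + w / ε * ε) :=
    Finset.sum_le_sum fun i _ => (hA.investment_run_le hε hβ.le hc hT le_rfl x t i).trans
      (add_le_add_right (mul_le_mul_of_nonneg_left (min_le_left _ _) hw) _)
  rw [hlen] at hsum
  linarith

lemma IsWarmupIPRR.isErrorOnline (hA : IsWarmupIPRR T.eval ε β A) (hε : 0 < ε) (hβ : 0 < β)
    (hc : ∀ i, 0 ≤ c i) : IsErrorOnline T.eval ε β c A := by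
  have hH := hA.halts hε hβ hc
  refine ⟨hH, ?_⟩
  obtain ⟨N, hN⟩ := exists_steps hH
  rw [dist, prob_eq_expect, expect_resample_run A β c N]
  refine (expect_mono fun x => ?_).trans_eq (expect_const ε)
  have hout : ∀ y, onlineOutput A β c (override (revealed (run A β c x N)) y)
      = onlineOutput A β c x := fun y => by
    have h := (hN (override (revealed (run A β c x N)) y)).2
    rw [run_override, (hN x).2] at h
    exact (Sum.inr.inj h).symm
  have hb := hA.bias_le (hN x).2
  have hval := (hA (run A β c x N)).2 hb
  rw [(hN x).2] at hval
  simp only [hout]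
  rw [← dist_majority, dist, prob_eq_expect] at hb
  rw [Sum.inr.inj hval]
  exact hb

lemma IsWarmupIPRR.avgOnlineCost_le (hA : IsWarmupIPRR T.eval ε β A) (hε : 0 < ε) (hβ : 0 < β)
    (hc : ∀ i, 0 ≤ c i) (hT : ∀ x, T.cost c x ≤ w) {s : ℝ} (hs : ε ≤ s) :
    avgOnlineCost A β c ≤ β * n
      + w / ε * ∑ i, maxPotential s (influence T.eval i) (influence T.eval i) := by
  have hw : 0 ≤ w / ε :=
    div_nonneg ((Finset.sum_nonneg fun i _ => hc i).trans (hT default)) hε.le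
  obtain ⟨N, hN⟩ := exists_steps (hA.halts hε hβ hc)
  calc avgOnlineCost A β c
      ≤ expect (fun x => ∑ i, (β + w / ε * min s (maxInfluence T.eval i (run A β c x N)))) := by
        refine expect_mono fun x => Finset.sum_le_sum fun i _ => ?_
        rw [← (hN x).1]
        exact hA.investment_run_le hε hβ.le hc hT hs x N i
    _ = ∑ i, (β + w / ε * expect (fun x => min s (maxInfluence T.eval i (run A β c x N)))) := by
        rw [expect_sum]
        refine Finset.sum_congr rfl fun i _ => ?_
        rw [expect_add, expect_const, expect_const_mul]
    _ ≤ ∑ i, (β + w / ε * maxPotential s (influence T.eval i) (influence T.eval i)) := by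
        refine Finset.sum_le_sum fun i _ => add_le_add_right (mul_le_mul_of_nonneg_left ?_ hw) _
        exact expect_min_maxInfluence_le _ (hε.trans_le hs) i N
    _ = _ := by
        rw [Finset.sum_add_distrib, ← Finset.mul_sum]
        simp [mul_comm]

end Warmup

lemma IsWarmupIPRR.avgOnlineCost_eq_zero {f : Cube n → Bool} {ε β : ℝ} {A : OnlineAlg n}
    (hA : IsWarmupIPRR f ε β A) (h : bias f ≤ ε) (c : Fin n → ℝ) : avgOnlineCost A β c = 0 := by
  have h0 : ∀ x, onlineCost A β c x = 0 := fun x => by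
    have := eq_finalHistory (x := x) (t := 0) (β := β) (c := c) ((hA []).2 h)
    rw [onlineCost, ← this]
    simp [run, investment]
  rw [avgOnlineCost, funext h0, expect_const]

/-- For `0 < a ≤ ε`, write `ln(ε/a) = ln n + ln(ε/(na))` and use `ln u ≤ u - 1`: the `-a` cancels
the leading `a`. The errors `ε/n` add up to only `ε` over all variables. -/
lemma maxPotential_self_le {ε a : ℝ} (hε : 0 < ε) (ha : 0 ≤ a) {n : ℕ} (hn : 2 ≤ n) :
    maxPotential ε a a ≤ a * Real.logb 2 n + ε / n := by
  have hn' : (2 : ℝ) ≤ n := by exact_mod_cast hn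
  have hn0 : (0 : ℝ) < n := by linarith
  have h1 : 1 ≤ Real.logb 2 n := by
    rw [Real.le_logb_iff_rpow_le (by norm_num) hn0]
    simpa using hn'
  have hlog : Real.log n ≤ Real.logb 2 n := by
    have h2 := Real.log_two_lt_d9
    have h2' := Real.log_pos one_lt_two
    have h3 : 0 ≤ Real.log n := Real.log_nonneg (by linarith)
    rw [Real.logb, le_div_iff₀ h2']
    nlinarith
  have hq : 0 < ε / n := by positivity
  unfold maxPotential
  rcases le_total ε a with h | h
  · rw [min_eq_left h, div_self hε.ne', Real.log_one]
    nlinarith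
  · rw [min_eq_right h]
    rcases ha.eq_or_lt with rfl | ha'
    · simpa using hq.le
    · have h4 : Real.log (ε / a) = Real.log (ε / n / a) + Real.log n := by
        rw [← Real.log_mul (by positivity) hn0.ne']
        congr 1
        field_simp
      have h5 := Real.log_le_sub_one_of_pos (x := ε / n / a) (by positivity)
      have h6 : a * (ε / n / a) = ε / n := by field_simp
      rw [h4]
      nlinarith

/-- A bound that is affine in the worst-case cost of an exact decision tree carries over to the
zero-error benchmark. -/
lemma le_add_optWorst_zero_mul {f : Cube n → Bool} {c : Fin n → ℝ} {a b q : ℝ} (hq : 0 ≤ q)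
    (h : ∀ (T : DecisionTree n) (w : ℝ), T.eval = f → (∀ x, T.cost c x ≤ w) → a ≤ b + w * q) :
    a ≤ b + optWorst 0 f c * q := by
  -- For `q = 0` one cannot divide by `q`, but any exact tree already gives `a ≤ b`.
  rcases hq.eq_or_lt with rfl | hq
  · obtain ⟨T, hT⟩ := exists_tree_of_dependsOn Finset.univ f
      fun x y hxy => by rw [funext fun i => hxy i (Finset.mem_univ i)]
    simpa using h T _ hT fun x => le_ciSup (Set.finite_range (T.cost c)).bddAbove x
  · have := le_optWorst_zero (f := f) (c := c) (a := (a - b) / q) fun T w hT hw => by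
      rw [div_le_iff₀ hq]
      linarith [h T w hT hw]
    rw [div_le_iff₀ hq] at this
    linarith

end PricedQuery

open PricedQuery in
theorem theorem4p3 :
    ∃ K : ℝ, 0 < K ∧
      ∀ (n : ℕ) (f : Cube n → Bool) (ε β : ℝ), 0 < ε → ε ≤ 1 / 2 → 0 < β →
        (∃ A : OnlineAlg n, IsWarmupIPRR f ε β A) ∧
        ∀ A : OnlineAlg n, IsWarmupIPRR f ε β A →
          ∀ c : Fin n → ℝ, (∀ i, 0 ≤ c i) →
            IsErrorOnline f ε β c A ∧
            avgOnlineCost A β c ≤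
              β * n + optWorst 0 f c / ε *
                ∑ i, influence f i * (1 + Real.log (1 / influence f i)) ∧
            (2 ≤ n →
              avgOnlineCost A β c ≤
                β * n + K * (optWorst 0 f c * (totalInfluence f * Real.logb 2 n / ε))) := by
  refine ⟨2, two_pos, fun n f ε β hε hε' hβ => ⟨exists_isWarmupIPRR f β hε, fun A hA c hc =>
    ⟨?_, ?_, fun hn => ?_⟩⟩⟩
  · obtain ⟨T, rfl⟩ := exists_tree_of_dependsOn Finset.univ f
      fun x y hxy => by rw [funext fun i => hxy i (Finset.mem_univ i)]
    exact hA.isErrorOnline hε hβ hc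
  · have hpot : ∀ i, maxPotential 1 (influence f i) (influence f i)
        = influence f i * (1 + Real.log (1 / influence f i)) := fun i => by
      rw [maxPotential, min_eq_right (influence_le_one f i)]
      ring
    have hnn : ∀ i, 0 ≤ influence f i * (1 + Real.log (1 / influence f i)) := fun i => by
      rw [← hpot]
      exact add_nonneg (le_min zero_le_one (influence_nonneg f i))
        (mul_nonneg (influence_nonneg f i) (log_div_min_nonneg one_pos (influence_nonneg f i)))
    rw [div_mul_eq_mul_div, mul_div_assoc]
    refine le_add_optWorst_zero_mul
      (div_nonneg (Finset.sum_nonneg fun i _ => hnn i) hε.le) fun T w hT hw => ?_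
    subst hT
    -- Influences never exceed `1`, so truncating at `1` loses nothing.
    have := hA.avgOnlineCost_le hε hβ hc hw (s := 1) (by linarith)
    simp only [hpot] at this
    rwa [div_mul_eq_mul_div, mul_div_assoc] at this
  · have hn' : (2 : ℝ) ≤ n := by exact_mod_cast hn
    have hlog : 1 ≤ Real.logb 2 n := by
      rw [Real.le_logb_iff_rpow_le (by norm_num) (by linarith)]
      simpa using hn'
    have hI : 0 ≤ totalInfluence f := Finset.sum_nonneg fun i _ => influence_nonneg f i
    have hq : 0 ≤ 2 * (totalInfluence f * Real.logb 2 n / ε) := by positivity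
    rw [show ∀ a b : ℝ, 2 * (a * b) = a * (2 * b) from fun a b => by ring]
    refine le_add_optWorst_zero_mul hq fun T w hT hw => ?_
    have hw0 : 0 ≤ w := (Finset.sum_nonneg fun i _ => hc i).trans (hw default)
    -- If `bias f ≤ ε`, the algorithm halts at once at no cost. Otherwise `ε < bias f ≤
    -- totalInfluence f`, which absorbs the additive `ε` and yields the constant `2`.
    rcases le_or_gt (bias f) ε with hb | hb
    · rw [hA.avgOnlineCost_eq_zero hb]
      positivity
    · subst hT
      have hsum : ∑ i, maxPotential ε (influence T.eval i) (influence T.eval i)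
          ≤ 2 * (totalInfluence T.eval * Real.logb 2 n) := by
        refine (Finset.sum_le_sum fun i _ =>
          maxPotential_self_le hε (influence_nonneg T.eval i) hn).trans ?_
        rw [Finset.sum_add_distrib, ← Finset.sum_mul]
        have h1 : ∑ _i : Fin n, ε / n = ε := by
          simp only [Finset.sum_const, Finset.card_univ, Fintype.card_fin, nsmul_eq_mul]
          field_simp
        have h2 := bias_le_totalInfluence T.eval
        change totalInfluence T.eval * Real.logb 2 n + _ ≤ _
        rw [h1]
        nlinarith
      calc avgOnlineCost A β c
          ≤ β * n + w / ε * ∑ i, maxPotential ε (influence T.eval i) (influence T.eval i) :=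
            hA.avgOnlineCost_le hε hβ hc hw le_rfl
        _ ≤ β * n + w / ε * (2 * (totalInfluence T.eval * Real.logb 2 n)) := by gcongr
        _ = _ := by ring
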